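/- Let $n \ge 1$ and $0 \le d \le n-1$ be integers, and let $K \subseteq \mathbb{R}^n$ be a compact convex set of dimension $d+1$ (that is, the affine hull of $K$ has dimension $d+1$). Then there exists a compact convex set $L \subseteq \mathbb{R}^n$ such that for every $d$-dimensional linear subspace $\xi$ of $\mathbb{R}^n$, the orthogonal projection $L_\xi$ of $L$ onto $\xi$ contains a translate of the orthogonal projection $K_\xi$ of $K$ onto $\xi$ (that is, $K_\xi + v \subseteq L_\xi$ for some $v \in \xi$), while $L$ contains no translate of $K$ (that is, there is no $w \in \mathbb{R}^n$ with $K + w \subseteq L$). -/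

import Mathlib

/-- The dimension of a set in a real vector space: the dimension of its affine hull. For a nonempty
set this is the usual dimension of a convex set (it is `0` for a point and for the empty set). -/
noncomputable def affineDim {V : Type*} [AddCommGroup V] [Module ℝ V] (K : Set V) : ℕ :=
  Module.finrank ℝ (affineSpan ℝ K).direction

/-- The shadow of `K` on the subspace `ξ`: the orthogonal projection of `K` onto `ξ`,
as a subset of `ξ`. -/
noncomputable def shadow {n : ℕ} (K : Set (EuclideanSpace ℝ (Fin n)))
    (ξ : Submodule ℝ (EuclideanSpace ℝ (Fin n))) : Set ξ :=
  ξ.orthogonalProjectionOnto '' K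

/-- `L` contains a translate of `K`: there is a vector `v` with `K + v ⊆ L`. -/
def ContainsTranslate {V : Type*} [AddCommGroup V] (L K : Set V) : Prop :=
  ∃ v : V, ∀ x ∈ K, x + v ∈ L

/-! Inside the direction space `V` of the affine hull, of dimension `d + 1`, every projection to a
`d`-dimensional `ξ` kills some line `ℝu`. So it suffices to find `L` into which no translate of `K`
fits, but into which one does fit once each point may slide along `u`. Take `x i ∈ K` exposed with a
quadratic gap by functionals `f i` summing to zero (`exists_affineBasis_exposing`), and let `L` be
the simplex `f i ≤ f i (x i) - τ`. Summing these inequalities over the `x i` excludes any translate.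
For the slides, translate so that only the facet `p` with `|f p u|` maximal can be violated. This
happens only near `x p`, where the other facets have room for a corrective slide. -/

open scoped InnerProductSpace

/-! ### Simplex vertices exposed with a quadratic gap -/

section ExposingFunctionals

/-- `N ∑ ‖x i‖² - ‖∑ x i‖²`, which is half the sum of the squared mutual distances of the `x i`. -/
noncomputable def spread {W ι : Type*} [NormedAddCommGroup W] [Fintype ι] (x : ι → W) : ℝ :=
  Fintype.card ι * ∑ i, ‖x i‖ ^ 2 - ‖∑ i, x i‖ ^ 2

theorem continuous_spread {W ι : Type*} [NormedAddCommGroup W] [Fintype ι] :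
    Continuous (fun x : ι → W => spread x) := by
  unfold spread
  fun_prop

variable {V : Type*} [NormedAddCommGroup V] [InnerProductSpace ℝ V]

/-- The expansion is exact: the linear term enters the exposing functional, and the quadratic term
becomes the gap. -/
theorem spread_update {ι : Type*} [Fintype ι] [DecidableEq ι] (x : ι → V) (i : ι) (y : V) :
    spread (Function.update x i y) = spread x
      + 2 * ⟪(Fintype.card ι : ℝ) • x i - ∑ j, x j, y - x i⟫_ℝ
      + (Fintype.card ι - 1) * ‖y - x i‖ ^ 2 := by
  have h1 : ∑ j, ‖Function.update x i y j‖ ^ 2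
      = ∑ j, ‖x j‖ ^ 2 + 2 * ⟪x i, y - x i⟫_ℝ + ‖y - x i‖ ^ 2 := by
    have hy : ‖y‖ ^ 2 = ‖x i‖ ^ 2 + 2 * ⟪x i, y - x i⟫_ℝ + ‖y - x i‖ ^ 2 := by
      rw [← norm_add_sq_real, add_sub_cancel]
    rw [← Finset.add_sum_erase _ _ (Finset.mem_univ i),
      ← Finset.add_sum_erase _ (fun j => ‖x j‖ ^ 2) (Finset.mem_univ i),
      Finset.sum_congr rfl fun j hj => by
        rw [Function.update_of_ne (Finset.ne_of_mem_erase hj)]]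
    rw [Function.update_self, hy]
    ring
  have h2 : ∑ j, Function.update x i y j = ∑ j, x j + (y - x i) := by
    rw [← Finset.add_sum_erase _ _ (Finset.mem_univ i),
      ← Finset.add_sum_erase _ x (Finset.mem_univ i),
      Finset.sum_congr rfl fun j hj => by
        rw [Function.update_of_ne (Finset.ne_of_mem_erase hj)]]
    rw [Function.update_self]
    abel
  rw [spread, spread, h1, h2, norm_add_sq_real, inner_sub_left, real_inner_smul_left]
  ring

theorem AffineBasis.det_toMatrix_update {ι : Type*} [Fintype ι] [DecidableEq ι]
    (b b₂ : AffineBasis ι ℝ V) (i : ι) (y : V) :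
    (b.toMatrix (Function.update b₂ i y)).det = (b.toMatrix b₂).det * b₂.coord i y := by
  have h := congrFun (b.det_smul_coords_eq_cramer_coords b₂ y) i
  rw [Matrix.cramer_transpose_apply, Pi.smul_apply, smul_eq_mul, AffineBasis.coords_apply] at h
  rw [h]
  congr 1
  ext j k
  rcases eq_or_ne j i with rfl | hj
  · simp
  · simp [hj]

theorem AffineBasis.sum_linear_coord {ι : Type*} [Fintype ι] (b : AffineBasis ι ℝ V) (v : V) :
    ∑ i, (b.coord i).linear v = 0 := by
  have h : ∀ i, (b.coord i).linear v = b.coord i v - b.coord i 0 := fun i => by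
    simpa using (b.coord i).linearMap_vsub v 0
  simp only [h]
  rw [Finset.sum_sub_distrib, b.sum_coord_apply_eq_one, b.sum_coord_apply_eq_one, sub_self]

theorem AffineBasis.sum_linear_coord_smul {ι : Type*} [Fintype ι] (b : AffineBasis ι ℝ V)
    (v : V) : ∑ i, (b.coord i).linear v • b i = v := by
  have h : ∀ i, (b.coord i).linear v = b.coord i v - b.coord i 0 := fun i => by
    simpa using (b.coord i).linearMap_vsub v 0
  simp only [h, sub_smul]
  rw [Finset.sum_sub_distrib, b.linear_combination_coord_eq_self,
    b.linear_combination_coord_eq_self, sub_zero]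

/-- A compact spanning set contains the vertices of a simplex each of which is exposed, with a
quadratic gap, by a linear functional, where the functionals have the constant tuples as their
only linear relations. -/
theorem exists_affineBasis_exposing [FiniteDimensional ℝ V] [Nontrivial V] (K : Set V)
    (hK : IsCompact K) (hspan : affineSpan ℝ K = ⊤) :
    ∃ (s : Set V) (_ : Fintype s) (x : s → V) (f : s → V →ₗ[ℝ] ℝ) (c : ℝ),
      Fintype.card s = Module.finrank ℝ V + 1 ∧ (∀ i, x i ∈ K) ∧ Function.Injective x ∧
      (∀ v, ∑ i, f i v = 0) ∧ (∀ v, (∀ i, f i v = 0) → v = 0) ∧ 0 < c ∧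
      ∀ i, ∀ y ∈ K, f i y + c * ‖y - x i‖ ^ 2 ≤ f i (x i) := by
  classical
  obtain ⟨s, hs, b, hb⟩ := AffineBasis.exists_affine_subbasis hspan
  have : Finite s := b.finite
  have := Fintype.ofFinite s
  have hcard : Fintype.card s = Module.finrank ℝ V + 1 := b.card_eq_finrank_add_one
  have hc1 : (1 : ℝ) ≤ Fintype.card s - 1 := by
    have : 1 ≤ Module.finrank ℝ V := Module.finrank_pos
    rw [hcard]
    push_cast
    have : (1 : ℝ) ≤ Module.finrank ℝ V := by exact_mod_cast this
    linarith
  have hbK : ∀ i, b i ∈ K := fun i => by rw [hb]; exact hs i.2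
  have hP : IsCompact (Set.univ.pi fun _ : s => K) := isCompact_univ_pi fun _ => hK
  have hbP : (b : s → V) ∈ Set.univ.pi fun _ : s => K := fun i _ => hbK i
  have hdet : Continuous fun x : s → V => |(b.toMatrix x).det| := by
    refine (Continuous.matrix_det ?_).abs
    refine continuous_matrix fun i j => ?_
    exact (b.coord j).continuous_of_finiteDimensional.comp (continuous_apply i)
  obtain ⟨C, hC⟩ := (hP.image continuous_spread).isBounded.exists_norm_le
  have hC' : ∀ x ∈ Set.univ.pi (fun _ : s => K), |spread x| ≤ C := fun x hx =>
    hC _ ⟨x, hx, rfl⟩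
  have hC0 : 0 ≤ C := (abs_nonneg _).trans (hC' _ hbP)
  -- Since `b` has determinant 1, a maximizer of `|det| + η * spread` has `|det| ≥ 1 - 2ηC > 0`. The
  -- determinant alone could be maximized with ties; the spread makes each vertex strictly exposed.
  set η : ℝ := 1 / (4 * (C + 1)) with hη
  have hη0 : 0 < η := by positivity
  have hηC : η * C < 1 / 2 := by
    rw [hη, div_mul_eq_mul_div, div_lt_div_iff₀ (by positivity) (by norm_num)]
    linarith
  obtain ⟨x, hxP, hmax⟩ : ∃ x ∈ Set.univ.pi fun _ : s => K, ∀ y ∈ Set.univ.pi fun _ : s => K,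
      |(b.toMatrix y).det| + η * spread y ≤ |(b.toMatrix x).det| + η * spread x :=
    hP.exists_isMaxOn ⟨_, hbP⟩
    (hdet.add (continuous_const.mul continuous_spread) :
      Continuous fun x : s → V => |(b.toMatrix x).det| + η * spread x).continuousOn
  have hD : 0 < |(b.toMatrix x).det| := by
    have h1 := hmax _ hbP
    rw [AffineBasis.toMatrix_self, Matrix.det_one, abs_one] at h1
    have h2 := mul_le_mul_of_nonneg_left (neg_le_of_abs_le (hC' _ hbP)) hη0.le
    have h3 := mul_le_mul_of_nonneg_left (le_of_abs_le (hC' _ hxP)) hη0.le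
    linarith
  have hunit : IsUnit (b.toMatrix x) := by
    rw [Matrix.isUnit_iff_isUnit_det, isUnit_iff_ne_zero]
    exact abs_pos.mp hD
  obtain ⟨hi, ht⟩ := (b.isUnit_toMatrix_iff x).mp hunit
  let a : AffineBasis s ℝ V := ⟨x, hi, ht⟩
  have ha : (a : s → V) = x := rfl
  set D := |(b.toMatrix x).det| with hDdef
  -- The derivative of the maximized quantity in its `i`-th vertex.
  let f : s → V →ₗ[ℝ] ℝ := fun i => D • (a.coord i).linear
    + (2 * η) • (innerₛₗ ℝ ((Fintype.card s : ℝ) • x i - ∑ j, x j))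
  have hf : ∀ i v, f i v = D * (a.coord i).linear v
      + 2 * η * ⟪(Fintype.card s : ℝ) • x i - ∑ j, x j, v⟫_ℝ := fun i v => rfl
  refine ⟨s, inferInstance, x, f, η * (Fintype.card s - 1), hcard, fun i => hxP i trivial,
    hi.injective, fun v => ?_, fun v hv => ?_, by positivity, fun i y hy => ?_⟩
  · simp only [hf]
    rw [Finset.sum_add_distrib, ← Finset.mul_sum, ← Finset.mul_sum, a.sum_linear_coord,
      ← sum_inner, Finset.sum_sub_distrib, ← Finset.smul_sum, Finset.sum_const,
      Finset.card_univ, ← Nat.cast_smul_eq_nsmul ℝ, sub_self, inner_zero_left]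
    simp
  -- Pairing with the barycentric coordinates turns `f` into a positive definite form in `v`.
  · have h0 : ∑ i, (a.coord i).linear v * f i v = 0 :=
      Finset.sum_eq_zero fun i _ => by rw [hv, mul_zero]
    have h1 : ∑ i, (a.coord i).linear v * f i v = D * ∑ i, ((a.coord i).linear v) ^ 2
        + 2 * η * Fintype.card s * ‖v‖ ^ 2 := by
      have h2 : ∑ i, (a.coord i).linear v * ⟪(Fintype.card s : ℝ) • x i - ∑ j, x j, v⟫_ℝ
          = Fintype.card s * ‖v‖ ^ 2 := by
        simp_rw [← real_inner_smul_left]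
        rw [← sum_inner]
        simp_rw [smul_sub]
        rw [Finset.sum_sub_distrib, ← Finset.sum_smul, a.sum_linear_coord, zero_smul, sub_zero]
        simp_rw [smul_comm _ (Fintype.card s : ℝ)]
        rw [← Finset.smul_sum, ← ha, a.sum_linear_coord_smul, real_inner_smul_left,
          real_inner_self_eq_norm_sq]
      rw [mul_assoc, ← h2, Finset.mul_sum, Finset.mul_sum, ← Finset.sum_add_distrib]
      refine Finset.sum_congr rfl fun i _ => ?_
      rw [hf]
      ring
    rw [h0] at h1
    have h3 : 0 ≤ D * ∑ i, ((a.coord i).linear v) ^ 2 :=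
      mul_nonneg hD.le (Finset.sum_nonneg fun i _ => sq_nonneg _)
    have h4 : 0 < 2 * η * Fintype.card s := by
      have : (0 : ℝ) < Fintype.card s := by linarith
      positivity
    by_contra hne
    have := mul_pos h4 (pow_pos (norm_pos_iff.mpr hne) 2)
    linarith
  · have hu : Function.update x i y ∈ Set.univ.pi fun _ : s => K := fun j _ => by
      rcases eq_or_ne j i with rfl | hj
      · simpa using hy
      · simpa [hj] using hxP j trivial
    have h1 := hmax _ hu
    rw [spread_update, ← ha, b.det_toMatrix_update a i y, ha, abs_mul, ← hDdef] at h1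
    have h2 := mul_le_mul_of_nonneg_left (le_abs_self (a.coord i y)) hD.le
    have h3 : (a.coord i).linear (y - x i) = a.coord i y - 1 := by
      have := (a.coord i).linearMap_vsub y (x i)
      rw [vsub_eq_sub, vsub_eq_sub] at this
      rw [this, ← ha, a.coord_apply_eq]
    have h4 : f i y = f i (x i) + f i (y - x i) := by rw [← map_add, add_sub_cancel]
    rw [h4, hf i (y - x i), h3]
    linarith

end ExposingFunctionals

/-! ### The shrunken simplex and sliding along a line -/

section ShrunkenSimplex

/-- If `f` is injective and its components sum to zero on a space of dimension one less than
their number, then every tuple with sum zero is attained. -/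
theorem exists_eq_of_sum_eq_zero {V ι : Type*} [AddCommGroup V] [Module ℝ V]
    [FiniteDimensional ℝ V] [Fintype ι] (f : ι → V →ₗ[ℝ] ℝ)
    (hcard : Fintype.card ι = Module.finrank ℝ V + 1) (hsum : ∀ v, ∑ i, f i v = 0)
    (hinj : ∀ v, (∀ i, f i v = 0) → v = 0) (w : ι → ℝ) (hw : ∑ i, w i = 0) :
    ∃ v, ∀ i, f i v = w i := by
  classical
  let σ : (ι → ℝ) →ₗ[ℝ] ℝ := ∑ i, LinearMap.proj i
  have hσ : ∀ w, σ w = ∑ i, w i := fun w => by simp [σ]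
  let g : V →ₗ[ℝ] LinearMap.ker σ :=
    (LinearMap.pi f).codRestrict _ fun v => by simp [hσ, hsum]
  have hne : Nonempty ι := Fintype.card_pos_iff.mp (by omega)
  have hsurj : Function.Surjective σ := fun r => by
    obtain ⟨i⟩ := hne
    exact ⟨Pi.single i r, by simp [hσ]⟩
  have hrank : Module.finrank ℝ (LinearMap.ker σ) = Module.finrank ℝ V := by
    have := σ.finrank_range_add_finrank_ker
    rw [LinearMap.range_eq_top.mpr hsurj, finrank_top, Module.finrank_self,
      Module.finrank_fintype_fun_eq_card] at this
    omega
  have hginj : Function.Injective g := by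
    rw [injective_iff_map_eq_zero]
    intro v hv
    refine hinj v fun i => ?_
    simpa [g] using congrFun (congrArg Subtype.val hv) i
  obtain ⟨v, hv⟩ := (LinearMap.injective_iff_surjective_of_finrank_eq_finrank hrank.symm).mp
    hginj ⟨w, by simp [hσ, hw]⟩
  exact ⟨v, fun i => by simpa [g] using congrFun (congrArg Subtype.val hv) i⟩

/-- As the `f i` sum to zero, upper bounds on all of them force lower bounds. -/
theorem isCompact_setOf_forall_le {V ι : Type*} [NormedAddCommGroup V] [NormedSpace ℝ V]
    [FiniteDimensional ℝ V] [Fintype ι] (f : ι → V →ₗ[ℝ] ℝ) (hsum : ∀ v, ∑ i, f i v = 0)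
    (hinj : ∀ v, (∀ i, f i v = 0) → v = 0) (a : ι → ℝ) :
    IsCompact {v | ∀ i, f i v ≤ a i} := by
  classical
  have hker : LinearMap.ker (LinearMap.pi f) = ⊥ := by
    rw [LinearMap.ker_eq_bot']
    exact fun v hv => hinj v fun i => by simpa using congrFun hv i
  have hcpt := (LinearMap.isClosedEmbedding_of_injective hker).isCompact_preimage
    (isCompact_Icc (a := fun i => -∑ j ∈ Finset.univ.erase i, a j) (b := a))
  have : {v | ∀ i, f i v ≤ a i}
      = LinearMap.pi f ⁻¹' Set.Icc (fun i => -∑ j ∈ Finset.univ.erase i, a j) a := by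
    ext v
    refine ⟨fun hv => ⟨fun i => ?_, fun i => by simpa using hv i⟩,
      fun hv i => by simpa using hv.2 i⟩
    have h1 := hsum v
    rw [← Finset.add_sum_erase _ _ (Finset.mem_univ i)] at h1
    have h2 := Finset.sum_le_sum fun j (_ : j ∈ Finset.univ.erase i) => hv j
    simp only [LinearMap.pi_apply]
    linarith
  rw [this]
  exact hcpt

theorem convex_setOf_forall_le {V ι : Type*} [AddCommGroup V] [Module ℝ V]
    (f : ι → V →ₗ[ℝ] ℝ) (a : ι → ℝ) : Convex ℝ {v | ∀ i, f i v ≤ a i} := by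
  rw [Set.ofPred_forall]
  exact convex_iInter fun i => convex_halfSpace_le (f i).isLinear (a i)

/-- A compact set spanning a space of positive dimension does not fit into some compact convex
set, although it does after projection along any line. -/
theorem exists_convex_containing_line_shadows {V : Type*} [NormedAddCommGroup V]
    [InnerProductSpace ℝ V] [FiniteDimensional ℝ V] [Nontrivial V] (K : Set V)
    (hK : IsCompact K) (hspan : affineSpan ℝ K = ⊤) :
    ∃ L : Set V, IsCompact L ∧ Convex ℝ L ∧
      (∀ u : V, u ≠ 0 → ∃ t : V, ∀ x ∈ K, ∃ s : ℝ, x + t + s • u ∈ L) ∧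
      ¬ ContainsTranslate L K := by
  classical
  obtain ⟨S, _, x, f, c, hcard, hxK, hxinj, hsum, hinj, hc, hgap⟩ :=
    exists_affineBasis_exposing K hK hspan
  have hne : Nonempty S := Fintype.card_pos_iff.mp (by omega)
  have hN : (0 : ℝ) < Fintype.card S := by exact_mod_cast Fintype.card_pos
  -- With this `κ`, no point of `K` is within `κ` of the maximum of two different `f i`. The value 1
  -- on the diagonal only keeps the minimum positive.
  obtain ⟨κ, hκ0, hκ⟩ : ∃ κ > 0, ∀ i j, i ≠ j → 4 * κ ≤ c * ‖x i - x j‖ ^ 2 := by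
    have hpos : ∀ q : S × S, 0 < if q.1 = q.2 then 1 else c * ‖x q.1 - x q.2‖ ^ 2 := fun q => by
      split_ifs with h
      · exact one_pos
      · have := norm_pos_iff.mpr (sub_ne_zero.mpr (hxinj.ne h))
        positivity
    obtain ⟨q, hq⟩ := Finite.exists_min fun q : S × S =>
      if q.1 = q.2 then 1 else c * ‖x q.1 - x q.2‖ ^ 2
    refine ⟨_, div_pos (hpos q) (by norm_num : (0 : ℝ) < 4), fun i j hij => ?_⟩
    have := hq (i, j)
    simp only [if_neg hij] at this
    linarith
  have hsep : ∀ y ∈ K, ∀ i j, i ≠ j → f i (x i) - κ < f i y → f j y ≤ f j (x j) - κ := by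
    intro y hy i j hij hi
    by_contra! hj
    have h1 : c * ‖y - x i‖ ^ 2 < κ := by linarith [hgap i y hy]
    have h2 : c * ‖y - x j‖ ^ 2 < κ := by linarith [hgap j y hy]
    have h3 : ‖x i - x j‖ ≤ ‖y - x i‖ + ‖y - x j‖ := by
      rw [← norm_neg (y - x i), neg_sub]
      simpa using norm_add_le (x i - y) (y - x j)
    have h4 : ‖x i - x j‖ ^ 2 ≤ 2 * (‖y - x i‖ ^ 2 + ‖y - x j‖ ^ 2) :=
      (pow_le_pow_left₀ (norm_nonneg _) h3 2).trans (add_sq_le)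
    have h5 := mul_le_mul_of_nonneg_left h4 hc.le
    linarith [hκ i j hij]
  set τ := κ / Fintype.card S with hτ
  have hτ0 : 0 < τ := by positivity
  have hτκ : Fintype.card S * τ = κ := by rw [hτ]; field_simp
  refine ⟨{v | ∀ i, f i v ≤ f i (x i) - τ}, isCompact_setOf_forall_le f hsum hinj _,
    convex_setOf_forall_le f _, fun u hu => ?_, ?_⟩
  · obtain ⟨p, hp⟩ := Finite.exists_max fun i => |f i u|
    have hp0 : f p u ≠ 0 := fun h => hu <| hinj u fun i => by
      have := hp i
      rw [h, abs_zero] at this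
      exact abs_nonpos_iff.mp this
    -- All facets but `p` gain the room `τ`, paid for at `p`; the values sum to zero because `κ =
    -- card S * τ`.
    obtain ⟨t, ht⟩ := exists_eq_of_sum_eq_zero f hcard hsum hinj
      (fun i => (if i = p then κ else 0) - τ) (by
        rw [Finset.sum_sub_distrib, Finset.sum_ite_eq', if_pos (Finset.mem_univ p),
          Finset.sum_const, Finset.card_univ, nsmul_eq_mul, hτκ, sub_self])
    refine ⟨t, fun y hy => ?_⟩
    rcases le_or_gt (f p y) (f p (x p) - κ) with hle | hgt
    · refine ⟨0, fun i => ?_⟩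
      rw [zero_smul, add_zero, map_add, ht]
      split_ifs with h
      · subst h
        linarith
      · have := mul_nonneg hc.le (sq_nonneg ‖y - x i‖)
        linarith [hgap i y hy]
    -- This slide lowers `f p` by `κ` and, by maximality of `|f p u|`, raises every other `f i` by
    -- at most `κ`.
    · refine ⟨-κ / f p u, fun i => ?_⟩
      rw [map_add, map_add, map_smul, ht, smul_eq_mul]
      split_ifs with h
      · subst h
        rw [div_mul_cancel₀ _ hp0]
        have := mul_nonneg hc.le (sq_nonneg ‖y - x i‖)
        linarith [hgap i y hy]
      · have h1 : -κ / f p u * f i u ≤ κ := by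
          refine (le_abs_self _).trans ?_
          rw [abs_mul, abs_div, abs_neg, abs_of_pos hκ0, div_mul_eq_mul_div,
            div_le_iff₀ (abs_pos.mpr hp0)]
          exact mul_le_mul_of_nonneg_left (hp i) hκ0.le
        linarith [hsep y hy p i (Ne.symm h) hgt]
  · rintro ⟨w, hw⟩
    have h1 : ∑ i, (f i (x i) + f i w) ≤ ∑ i, (f i (x i) - τ) :=
      Finset.sum_le_sum fun i _ => by simpa using hw (x i) (hxK i) i
    rw [Finset.sum_add_distrib, Finset.sum_sub_distrib, hsum] at h1
    simp only [Finset.sum_const, Finset.card_univ, nsmul_eq_mul, hτκ] at h1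
    linarith

end ShrunkenSimplex

/-! ### Reduction to the affine hull -/

theorem corollary4p6 (n d : ℕ) (hd : d + 1 ≤ n) (K : Set (EuclideanSpace ℝ (Fin n)))
    (hKcompact : IsCompact K) (hKconvex : Convex ℝ K) (hKdim : affineDim K = d + 1) :
    ∃ L : Set (EuclideanSpace ℝ (Fin n)), IsCompact L ∧ Convex ℝ L ∧
      (∀ ξ : Submodule ℝ (EuclideanSpace ℝ (Fin n)), Module.finrank ℝ ξ = d →
        ContainsTranslate (shadow L ξ) (shadow K ξ)) ∧
      ¬ ContainsTranslate L K := by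
  set V := (affineSpan ℝ K).direction with hV
  have hVdim : Module.finrank ℝ V = d + 1 := hKdim
  have : Nontrivial V := Module.nontrivial_of_finrank_pos (R := ℝ) (by omega)
  have hKne : K.Nonempty := by
    rw [Set.nonempty_iff_ne_empty]
    rintro rfl
    rw [affineDim, AffineSubspace.span_empty, AffineSubspace.direction_bot, finrank_bot] at hKdim
    omega
  obtain ⟨b, hb⟩ := hKne
  let φ : V →ᵃ[ℝ] EuclideanSpace ℝ (Fin n) :=
    V.subtype.toAffineMap + AffineMap.const ℝ V b
  have hφ : ∀ v, φ v = (v : EuclideanSpace ℝ (Fin n)) + b := fun v => by simp [φ]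
  have hφinj : Function.Injective φ := fun v w h => by simpa [hφ] using h
  have hφcont : Continuous φ := φ.continuous_of_finiteDimensional
  have hφK : φ '' (φ ⁻¹' K) = K := by
    refine Set.image_preimage_eq_of_subset fun y hy => ?_
    exact ⟨⟨y - b, AffineSubspace.vsub_mem_direction (subset_affineSpan ℝ K hy)
      (subset_affineSpan ℝ K hb)⟩, by simp [hφ]⟩
  have hcpt : IsCompact (φ ⁻¹' K) := by
    have : Topology.IsClosedEmbedding φ := by
      have h : (φ : V → EuclideanSpace ℝ (Fin n)) = Homeomorph.addRight b ∘ Subtype.val := by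
        ext v : 1
        simp [hφ]
      rw [h]
      exact (Homeomorph.addRight b).isClosedEmbedding.comp
        V.closed_of_finiteDimensional.isClosedEmbedding_subtypeVal
    exact this.isCompact_preimage hKcompact
  have hspan : affineSpan ℝ (φ ⁻¹' K) = ⊤ := by
    refine eq_top_iff.mpr fun v _ => ?_
    have h1 : φ v ∈ affineSpan ℝ (φ '' (φ ⁻¹' K)) := by
      rw [hφK, hφ]
      exact AffineSubspace.vadd_mem_of_mem_direction v.2 (subset_affineSpan ℝ K hb)
    rw [← AffineSubspace.map_span] at h1
    obtain ⟨w, hw, hwv⟩ := h1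
    rwa [← hφinj hwv]
  obtain ⟨L, hLcpt, hLconv, hLproj, hLnot⟩ :=
    exists_convex_containing_line_shadows _ hcpt hspan
  refine ⟨φ '' L, hLcpt.image hφcont, hLconv.affine_image φ, fun ξ hξ => ?_, ?_⟩
  · let g : V →ₗ[ℝ] ξ := ξ.orthogonalProjectionOnto.toLinearMap ∘ₗ V.subtype
    have hg : ∀ v : V, g v = ξ.orthogonalProjectionOnto v := fun v => rfl
    obtain ⟨u, hu, hu0⟩ := (Submodule.ne_bot_iff _).mp
      (LinearMap.ker_ne_bot_of_finrank_lt (f := g) (by omega))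
    obtain ⟨t, ht⟩ := hLproj u hu0
    refine ⟨g t, ?_⟩
    rintro _ ⟨y, hy, rfl⟩
    rw [← hφK] at hy
    obtain ⟨v, hv, rfl⟩ := hy
    obtain ⟨s, hs⟩ := ht v hv
    refine ⟨_, ⟨_, hs, rfl⟩, ?_⟩
    have hu' : ξ.orthogonalProjectionOnto (u : EuclideanSpace ℝ (Fin n)) = 0 := hu
    simp only [hφ, hg, Submodule.coe_add, Submodule.coe_smul, map_add, map_smul, hu']
    rw [smul_zero]
    abel
  -- The image of `b ∈ K` stays in the affine hull, so `w` lies in `V`.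
  · rintro ⟨w, hw⟩
    obtain ⟨v, -, hv⟩ := hw b hb
    refine hLnot ⟨v, fun y hy => ?_⟩
    obtain ⟨z, hz, hzy⟩ := hw (φ y) hy
    have : z = y + v := by
      apply Subtype.ext
      simp only [hφ, Submodule.coe_add] at hv hzy ⊢
      have hvw : (v : EuclideanSpace ℝ (Fin n)) = w := by
        rw [add_comm b w] at hv
        exact add_right_cancel hv
      rw [hvw]
      apply add_right_cancel (b := b)
      rw [hzy]
      abel
    rwa [← this]
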